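/- Let $P$ be a poset, regarded as a category with a unique morphism $p\to q$ whenever $p\le q$. Let $X$ be the dcpo of filters on $P$ (nonempty, down-directed, upward closed subsets of $P$, ordered by inclusion), with the Scott topology, and identify $p\in P$ with the principal filter $\{q : p\le q\}\in X$. Then the presheaf topos $\mathsf{PSh}(P)$ is a coherent topos if and only if $X$ is a spectral space. Assume that this is the case, and let $S\subseteq X$ be a sober subspace. Then the following four conditions are equivalent: (a) $S$ is a patch in $X$, i.e. it is closed in the topology on $X$ that has as subbasis the compact open subsets of $X$ and their complements; (b) $S$ is a spectral subobject of $X$, i.e. $S$ with the subspace topology is a spectral space and $U\cap S$ is compact for every compact open $U\subseteq X$; (c) the Grothendieck topology $K_S$ on $P$ is of finite type, where a sieve $L$ on $p$ is $K_S$-covering if and only if every $x\in S$ with $p\le x$ in $X$ satisfies $q\le x$ in $X$ for some $q\in L$, and where a Grothendieck topology is of finite type if every covering sieve contains a finitely generated covering sieve; (d) $\mathsf{Sh}(S)\subseteq\mathsf{Sh}(X)$ is a coherent subtopos, i.e. the geometric morphism $\mathsf{Sh}(S)\to\mathsf{Sh}(X)$ induced by the inclusion is an inclusion of toposes, both toposes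 are coherent, and its inverse image functor preserves coherent objects. Here a spectral space is a sober compact space whose compact open sets are closed under binary intersection and form a basis. An object $E$ of a topos is compact if every epimorphic family with codomain $E$ contains a finite epimorphic subfamily; it is coherent if it is compact and $E'\times_E E''$ is compact for all morphisms $E'\to E\leftarrow E''$ with $E',E''$ compact. A coherent topos is a Grothendieck topos with a full subcategory of compact objects that generates it and is closed under finite limits. -/

import Mathlib

universe u v v' w w'

open CategoryTheory CategoryTheory.Limits Topology

section Topos

variable {C : Type w} [Category.{v} C]

/-- A family of morphisms with common codomain is epimorphic if two morphisms out of the codomain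
that agree after composition with every member of the family are equal. -/
def IsEpimorphicFamily {E : C} {ι : Type w'} (D : ι → C) (f : ∀ i, D i ⟶ E) : Prop :=
  ∀ ⦃Z : C⦄ (g h : E ⟶ Z), (∀ i, f i ≫ g = f i ≫ h) → g = h

/-- An object is compact if every epimorphic family with this codomain contains a finite
epimorphic subfamily. The universe of the index type is large enough for the family of all
morphisms into `E`. -/
def IsCompactObj (E : C) : Prop :=
  ∀ ⦃ι : Type (max v w)⦄ (D : ι → C) (f : ∀ i, D i ⟶ E), IsEpimorphicFamily D f →
    ∃ s : Finset ι, IsEpimorphicFamily (fun i : s => D i) (fun i : s => f i)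

/-- An object `E` is coherent if it is compact and every pullback of compact objects over `E`
is compact. -/
structure IsCoherentObj (E : C) : Prop where
  isCompactObj : IsCompactObj E
  isCompactObj_pullback : ∀ ⦃E₁ E₂ T : C⦄ (p₁ : T ⟶ E₁) (p₂ : T ⟶ E₂) (f₁ : E₁ ⟶ E) (f₂ : E₂ ⟶ E),
    IsPullback p₁ p₂ f₁ f₂ → IsCompactObj E₁ → IsCompactObj E₂ → IsCompactObj T

/-- A (Grothendieck) topos: a category equivalent to the category of sheaves on a small site. -/
def IsGrothendieckTopos (E : Type (u + 1)) [Category.{u} E] : Prop :=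
  ∃ (D : Type u) (_ : SmallCategory D) (J : GrothendieckTopology D),
    Nonempty (E ≌ Sheaf J (Type u))

/-- A coherent topos: a topos containing a full subcategory of compact generators that is closed
under finite limits. -/
structure IsCoherentTopos (E : Type (u + 1)) [Category.{u} E] : Prop where
  isTopos : IsGrothendieckTopos E
  exists_generators : ∃ K : ObjectProperty E, (∀ A, K A → IsCompactObj A) ∧ K.IsSeparating ∧
    ∀ (J : Type) [SmallCategory J] [FinCategory J], K.IsClosedUnderLimitsOfShape J

/-- A geometric morphism from `E` to `F`. -/
structure GeomMorphism (E : Type w) [Category.{v} E] (F : Type w') [Category.{v'} F] where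
  direct : E ⥤ F
  inverse : F ⥤ E
  adj : inverse ⊣ direct
  preservesFiniteLimits : PreservesFiniteLimits inverse

/-- A geometric morphism is an inclusion (it exhibits its source as a subtopos of its target) if
its direct image functor is fully faithful. -/
def GeomMorphism.IsInclusion {E : Type w} [Category.{v} E] {F : Type w'} [Category.{v'} F]
    (f : GeomMorphism E F) : Prop :=
  f.direct.Full ∧ f.direct.Faithful

/-- A coherent geometric morphism: a geometric morphism between coherent toposes whose inverse
image functor preserves coherent objects. -/
structure GeomMorphism.IsCoherent {E F : Type (u + 1)} [Category.{u} E] [Category.{u} F]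
    (f : GeomMorphism E F) : Prop where
  source : IsCoherentTopos E
  target : IsCoherentTopos F
  map_coherent : ∀ A : F, IsCoherentObj A → IsCoherentObj (f.inverse.obj A)

/-- The subtopos given by `f` is a coherent subtopos: `f` is an inclusion and is coherent
(in particular its source is a coherent topos). -/
def GeomMorphism.IsCoherentSubtopos {E F : Type (u + 1)} [Category.{u} E] [Category.{u} F]
    (f : GeomMorphism E F) : Prop :=
  f.IsInclusion ∧ f.IsCoherent

/-- The category `Sh(X)` of sheaves of sets on a topological space. -/
abbrev ShTop (X : Type u) [TopologicalSpace X] : Type (u + 1) :=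
  TopCat.Sheaf (Type u) (TopCat.of X)

/-- The geometric morphism `Sh(X) ⟶ Sh(Y)` induced by a continuous map. -/
noncomputable def GeomMorphism.ofTopCatHom {X Y : TopCat.{u}} (f : X ⟶ Y) :
    GeomMorphism (TopCat.Sheaf (Type u) X) (TopCat.Sheaf (Type u) Y) where
  direct := TopCat.Sheaf.pushforward (Type u) f
  inverse := TopCat.Sheaf.pullback (Type u) f
  adj := TopCat.Sheaf.pullbackPushforwardAdjunction (Type u) f
  preservesFiniteLimits := by
    unfold TopCat.Sheaf.pullback
    apply Functor.SmallCategories.instPreservesFiniteLimitsSheafSheafPullbackOfRepresentablyFlat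

/-- The geometric morphism `Sh(S) ⟶ Sh(X)` induced by the inclusion of a subspace. -/
noncomputable def GeomMorphism.ofSubspace {X : Type u} [TopologicalSpace X] (S : Set X) :
    GeomMorphism (ShTop S) (ShTop X) :=
  GeomMorphism.ofTopCatHom (TopCat.ofHom ⟨Subtype.val, continuous_subtype_val⟩)

/-- A Grothendieck topology is of finite type if every covering sieve contains a finitely
generated covering sieve. -/
def CategoryTheory.GrothendieckTopology.IsOfFiniteType (J : GrothendieckTopology C) : Prop :=
  ∀ ⦃X : C⦄ (L : Sieve X), L ∈ J X → ∃ (n : ℕ) (Y : Fin n → C) (f : ∀ i, Y i ⟶ X),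
    Sieve.ofArrows Y f ∈ J X ∧ Sieve.ofArrows Y f ≤ L

end Topos

section Spaces

variable {X : Type u} [TopologicalSpace X]

/-- A patch: a closed set for the patch topology, which has as subbasis the compact opens and
their complements. -/
def IsPatch (S : Set X) : Prop :=
  IsClosed[constructibleTopology X] S

/-- A spectral subobject: a subspace that is a spectral space and whose inclusion is a spectral
map. -/
def IsSpectralSubobject (S : Set X) : Prop :=
  SpectralSpace S ∧ IsSpectralMap (Subtype.val : S → X)

/-- A subspace is sober if each irreducible closed subset has a unique generic point. -/
def IsSoberSubspace (S : Set X) : Prop :=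
  T0Space S ∧ QuasiSober S

end Spaces

section Filters

variable {P : Type u} [PartialOrder P]

/-- The dcpo of filters on `P`, ordered by inclusion, carries the Scott topology. -/
instance Order.PFilter.instTopologicalSpaceScott : TopologicalSpace (Order.PFilter P) :=
  Topology.scott (Order.PFilter P) Set.univ

/-- The upward closure in the dcpo of filters of a sieve `L`, where elements of `P` are
identified with principal filters. -/
def sieveTilde {p : P} (L : Sieve p) : Set (Order.PFilter P) :=
  {x | ∃ (q : P) (f : q ⟶ p), L f ∧ Order.PFilter.principal q ≤ x}

/-- The Grothendieck topology `K_S` on `P` of a set `S` of filters: a sieve `L` on `p` is covering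
if and only if its upward closure contains all elements of `S` above (the principal filter
of) `p`. -/
def topologyOfSet (S : Set (Order.PFilter P)) : GrothendieckTopology P where
  sieves p := {L | {x | Order.PFilter.principal p ≤ x} ∩ S ⊆ sieveTilde L}
  top_mem' p x hx := ⟨p, 𝟙 p, trivial, hx.1⟩
  pullback_stable' p q L f hL x hx := by
    have hq : q ∈ x := Order.PFilter.principal_le_iff.1 hx.1
    obtain ⟨r, g, hg, hr⟩ :=
      hL ⟨Order.PFilter.principal_le_iff.2 (Order.PFilter.mem_of_le (leOfHom f) hq), hx.2⟩
    obtain ⟨t, ht, htq, htr⟩ := x.directed q hq r (Order.PFilter.principal_le_iff.1 hr)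
    refine ⟨t, homOfLE htq, ?_, Order.PFilter.principal_le_iff.2 ht⟩
    have := L.downward_closed hg (homOfLE htr)
    rwa [Subsingleton.elim (homOfLE htr ≫ g) (homOfLE htq ≫ f)] at this
  transitive' p L hL R hR x hx := by
    obtain ⟨q, f, hf, hq⟩ := hL hx
    obtain ⟨r, g, hg, hr⟩ := hR hf ⟨hq, hx.2⟩
    exact ⟨r, g ≫ f, hg, hr⟩

end Filters

/-!
The sets of filters containing a given `p ∈ P` form a basis of the filter space `X`. Such a set has
the principal filter of `p` as its least element, so it is covered by open sets only if one of them
contains it entirely. Hence `P` with the trivial topology is a dense subsite of the opens of `X`,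
and `PSh(P) ≌ Sh(X)`.

In `Sh(X)` the compact subterminal sheaves are the compact open sets of `X`, so for sober `X` the
topos `Sh(X)` is coherent exactly when `X` is spectral, and for spectral spaces the geometric
morphism of a continuous map is coherent exactly when the map is spectral.

Everything is therefore reduced to the inclusion `S → X` being spectral. This is a condition on the
basic compact open sets, where it reads off as `K_S` being of finite type. A patch is compact for
the constructible topology and so is its intersection with a compact open set; conversely a spectral
map is continuous for the constructible topologies, which are compact Hausdorff, so its image is a
patch.
-/

namespace IsEpimorphicFamily

section

variable {C : Type w} [Category.{v} C] {E : C} {ι : Type*} {D : ι → C} {f : ∀ i, D i ⟶ E}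

lemma of_factors {κ : Type*} {D' : κ → C} {f' : ∀ k, D' k ⟶ E} (hf' : IsEpimorphicFamily D' f')
    (h : ∀ k, ∃ i, ∃ a : D' k ⟶ D i, a ≫ f i = f' k) : IsEpimorphicFamily D f := by
  refine fun Z g g' hg => hf' g g' fun k => ?_
  obtain ⟨i, a, ha⟩ := h k
  rw [← ha, Category.assoc, Category.assoc, hg]

lemma of_epi {A : C} (a : A ⟶ E) [Epi a] : IsEpimorphicFamily (fun _ : PUnit => A) fun _ => a :=
  fun _ _ _ hg => (cancel_epi a).1 (hg ⟨⟩)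

lemma comp (hf : IsEpimorphicFamily D f) {κ : ι → Type*} {D' : ∀ i, κ i → C}
    {f' : ∀ i k, D' i k ⟶ D i} (hf' : ∀ i, IsEpimorphicFamily (D' i) (f' i)) :
    IsEpimorphicFamily (fun k : Σ i, κ i => D' k.1 k.2) fun k => f' k.1 k.2 ≫ f k.1 :=
  fun _ g g' hg => hf g g' fun i => hf' i _ _ fun k => by simpa using hg ⟨i, k⟩

lemma of_isSeparating {K : ObjectProperty C} (hK : K.IsSeparating) (E : C) :
    IsEpimorphicFamily (fun x : Σ A : Subtype K, A.1 ⟶ E => x.1.1) fun x => x.2 :=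
  fun _ g g' hg => hK g g' fun A hA a => hg ⟨⟨A, hA⟩, a⟩

lemma map {C' : Type*} [Category* C'] (F : C ⥤ C') [F.IsLeftAdjoint]
    (hf : IsEpimorphicFamily D f) :
    IsEpimorphicFamily (fun i => F.obj (D i)) fun i => F.map (f i) := by
  intro Z g g' hg
  let adj := Adjunction.ofIsLeftAdjoint F
  refine (adj.homEquiv _ _).injective (hf _ _ fun i => ?_)
  rw [← adj.homEquiv_naturality_left, ← adj.homEquiv_naturality_left, hg i]

end

end IsEpimorphicFamily

/-- The category `T` has pullbacks along which epimorphic families are stable, as in every topos.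
The index types are those over which compactness of objects is tested. -/
class StableEpimorphicFamilies (T : Type w) [Category.{v} T] : Prop extends HasPullbacks T where
  stable : ∀ {E E' : T} (g : E' ⟶ E) {ι : Type (max v w)} {D : ι → T}
    {f : ∀ i, D i ⟶ E}, IsEpimorphicFamily D f →
      IsEpimorphicFamily (fun i => pullback (f i) g) fun i => pullback.snd (f i) g

lemma IsEpimorphicFamily.pullback_snd {T : Type w} [Category.{v} T] [StableEpimorphicFamilies T]
    {E E' : T} {ι : Type (max v w)} {D : ι → T} {f : ∀ i, D i ⟶ E} (hf : IsEpimorphicFamily D f)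
    (g : E' ⟶ E) : IsEpimorphicFamily (fun i => pullback (f i) g) fun i => pullback.snd (f i) g :=
  StableEpimorphicFamilies.stable g hf

section CompactObj

variable {T : Type w} [Category.{v} T]

lemma isPullback_comp_comp [HasPullbacks T] {A₁ A₂ E₁ E₂ E : T} (a₁ : A₁ ⟶ E₁) (a₂ : A₂ ⟶ E₂)
    (f₁ : E₁ ⟶ E) (f₂ : E₂ ⟶ E) :
    IsPullback
      (pullback.snd a₂ (pullback.snd a₁ (pullback.fst f₁ f₂) ≫ pullback.snd f₁ f₂) ≫
        pullback.fst a₁ (pullback.fst f₁ f₂))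
      (pullback.fst a₂ (pullback.snd a₁ (pullback.fst f₁ f₂) ≫ pullback.snd f₁ f₂))
      (a₁ ≫ f₁) (a₂ ≫ f₂) :=
  (IsPullback.of_hasPullback a₂ _).flip.paste_horiz
    ((IsPullback.of_hasPullback a₁ _).paste_vert (.of_hasPullback f₁ f₂))

namespace IsCompactObj

lemma of_iso {E E' : T} (hE : IsCompactObj E) (e : E ≅ E') : IsCompactObj E' := by
  intro ι D f hf
  obtain ⟨s, hs⟩ := hE D (fun i => f i ≫ e.inv) fun Z g h H =>
    (cancel_epi e.inv).1 (hf _ _ fun i => by simpa using H i)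
  exact ⟨s, fun Z g h H => (cancel_epi e.hom).1 (hs _ _ fun i => by simpa using H i)⟩

lemma exists_cover {K : ObjectProperty T} (hK : K.IsSeparating) {E : T} (hE : IsCompactObj E)
    {ι : Type (max v w)} {D : ι → T} {f : ∀ i, D i ⟶ E} (hf : IsEpimorphicFamily D f) :
    ∃ (κ : Type (max v w)) (_ : Finite κ) (A : κ → T) (a : ∀ k, A k ⟶ E),
      IsEpimorphicFamily A a ∧ ∀ k, K (A k) ∧ ∃ i, ∃ b : A k ⟶ D i, b ≫ f i = a k := by
  obtain ⟨s, hs⟩ := hE _ _ (hf.comp fun i => .of_isSeparating hK (D i))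
  exact ⟨s, inferInstance, _, _, hs, fun k => ⟨k.1.2.1.2, k.1.1, k.1.2.2, rfl⟩⟩

variable [StableEpimorphicFamilies T]

lemma of_cover {E : T} {ι : Type (max v w)} [Finite ι] {D : ι → T} {d : ∀ i, D i ⟶ E}
    (hd : IsEpimorphicFamily D d) (hD : ∀ i, IsCompactObj (D i)) : IsCompactObj E := by
  classical
  intro κ A a ha
  choose s hs using fun i => hD i _ _ (ha.pullback_snd (d i))
  have := Fintype.ofFinite ι
  refine ⟨Finset.univ.biUnion s, (hd.comp hs).of_factors fun ⟨i, k, hk⟩ => ?_⟩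
  exact ⟨⟨k, Finset.mem_biUnion.2 ⟨i, Finset.mem_univ i, hk⟩⟩, pullback.fst (a k) (d i),
    pullback.condition⟩

lemma pullback_of_covers {E₁ E₂ E : T} (f₁ : E₁ ⟶ E) (f₂ : E₂ ⟶ E) {ι κ : Type (max v w)}
    [Finite ι] [Finite κ] {A : ι → T} {B : κ → T} {a : ∀ i, A i ⟶ E₁} {b : ∀ k, B k ⟶ E₂}
    (ha : IsEpimorphicFamily A a) (hb : IsEpimorphicFamily B b)
    (h : ∀ i k, IsCompactObj (pullback (a i ≫ f₁) (b k ≫ f₂))) :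
    IsCompactObj (pullback f₁ f₂) := by
  refine of_cover ((ha.pullback_snd (pullback.fst f₁ f₂)).comp fun i => hb.pullback_snd
    (pullback.snd (a i) (pullback.fst f₁ f₂) ≫ pullback.snd f₁ f₂)) fun ⟨i, k⟩ => ?_
  exact (h i k).of_iso (isPullback_comp_comp (a i) (b k) f₁ f₂).isoPullback.symm

end IsCompactObj

variable [StableEpimorphicFamilies T]

namespace IsCoherentObj

lemma isCompactObj_chosen_pullback {E E₁ E₂ : T} (hE : IsCoherentObj E) (f₁ : E₁ ⟶ E) (f₂ : E₂ ⟶ E)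
    (h₁ : IsCompactObj E₁) (h₂ : IsCompactObj E₂) : IsCompactObj (pullback f₁ f₂) :=
  hE.isCompactObj_pullback _ _ _ _ (.of_hasPullback f₁ f₂) h₁ h₂

lemma of_isCompactObj_pullback {E : T} (hE : IsCompactObj E)
    (h : ∀ ⦃E₁ E₂ : T⦄ (f₁ : E₁ ⟶ E) (f₂ : E₂ ⟶ E), IsCompactObj E₁ → IsCompactObj E₂ →
      IsCompactObj (pullback f₁ f₂)) : IsCoherentObj E :=
  ⟨hE, fun _ _ _ _ _ _ _ hp h₁ h₂ => (h _ _ h₁ h₂).of_iso hp.isoPullback.symm⟩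

lemma of_isSeparating {K : ObjectProperty T} (hK : K.IsSeparating) {E : T} (hE : IsCompactObj E)
    (h : ∀ ⦃A B : T⦄ (f : A ⟶ E) (g : B ⟶ E), K A → K B → IsCompactObj (pullback f g)) :
    IsCoherentObj E := by
  refine of_isCompactObj_pullback hE fun E₁ E₂ f₁ f₂ h₁ h₂ => ?_
  obtain ⟨ι, _, A, a, ha, hA⟩ := h₁.exists_cover hK (.of_epi (𝟙 E₁))
  obtain ⟨κ, _, B, b, hb, hB⟩ := h₂.exists_cover hK (.of_epi (𝟙 E₂))
  exact .pullback_of_covers f₁ f₂ ha hb fun i k => h _ _ (hA i).1 (hB k).1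

lemma isCompactObj_pullback_comp {A₁ A₂ E₁ E₂ E : T} (a₁ : A₁ ⟶ E₁) (a₂ : A₂ ⟶ E₂) (f₁ : E₁ ⟶ E)
    (f₂ : E₂ ⟶ E) (hE₁ : IsCoherentObj E₁) (hE₂ : IsCoherentObj E₂)
    (h : IsCompactObj (pullback f₁ f₂)) (hA₁ : IsCompactObj A₁) (hA₂ : IsCompactObj A₂) :
    IsCompactObj (pullback (a₁ ≫ f₁) (a₂ ≫ f₂)) :=
  (hE₂.isCompactObj_chosen_pullback _ _ hA₂ (hE₁.isCompactObj_chosen_pullback _ _ hA₁ h)).of_iso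
    (isPullback_comp_comp a₁ a₂ f₁ f₂).isoPullback

lemma of_cover {K : ObjectProperty T} (hK : K.IsSeparating) (hK' : ∀ ⦃A⦄, K A → IsCompactObj A)
    {E : T} {ι : Type (max v w)} [Finite ι] {D : ι → T} {d : ∀ i, D i ⟶ E}
    (hd : IsEpimorphicFamily D d) (hD : ∀ i, IsCoherentObj (D i))
    (h : ∀ i j, IsCompactObj (pullback (d i) (d j))) : IsCoherentObj E := by
  refine of_isSeparating hK (.of_cover hd fun i => (hD i).isCompactObj) fun E₁ E₂ f₁ f₂ h₁ h₂ => ?_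
  obtain ⟨κ, _, A, a, ha, hA⟩ := (hK' h₁).exists_cover hK (hd.pullback_snd f₁)
  obtain ⟨l, _, B, b, hb, hB⟩ := (hK' h₂).exists_cover hK (hd.pullback_snd f₂)
  refine .pullback_of_covers f₁ f₂ ha hb fun k m => ?_
  obtain ⟨hAk, i, s, hs⟩ := hA k
  obtain ⟨hBm, j, t, ht⟩ := hB m
  have ha_factors : a k ≫ f₁ = (s ≫ pullback.fst (d i) f₁) ≫ d i := by
    rw [← hs, Category.assoc, Category.assoc, pullback.condition]
  have hb_factors : b m ≫ f₂ = (t ≫ pullback.fst (d j) f₂) ≫ d j := by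
    rw [← ht, Category.assoc, Category.assoc, pullback.condition]
  exact (isCompactObj_pullback_comp _ _ _ _ (hD i) (hD j) (h i j) (hK' hAk) (hK' hBm)).of_iso
    (pullback.congrHom ha_factors hb_factors).symm

lemma of_isSeparating_of_isClosedUnderLimitsOfShape {K : ObjectProperty T} (hK : K.IsSeparating)
    (hK' : ∀ ⦃A⦄, K A → IsCompactObj A) [K.IsClosedUnderLimitsOfShape WalkingCospan] {E : T}
    (hE : K E) : IsCoherentObj E :=
  of_isSeparating hK (hK' hE) fun _ _ f g hA hB => hK' <|
    K.prop_limit _ (by rintro (_ | _ | _) <;> assumption)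

end IsCoherentObj

end CompactObj

section LeftAdjoint

variable {T T' : Type w} [Category.{v} T] [Category.{v} T'] [StableEpimorphicFamilies T']
  (F : T ⥤ T') [F.IsLeftAdjoint] {K : ObjectProperty T}

lemma IsCompactObj.map (hK : K.IsSeparating) (hF : ∀ ⦃A⦄, K A → IsCompactObj (F.obj A)) {E : T}
    (hE : IsCompactObj E) : IsCompactObj (F.obj E) := by
  obtain ⟨κ, _, A, a, ha, hA⟩ := hE.exists_cover hK (.of_epi (𝟙 E))
  exact .of_cover (ha.map F) fun k => hF (hA k).1

variable [StableEpimorphicFamilies T]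

lemma IsCoherentObj.map [PreservesLimitsOfShape WalkingCospan F] (hK : K.IsSeparating)
    (hK' : ∀ ⦃A⦄, K A → IsCompactObj A) (hF : ∀ ⦃A⦄, K A → IsCoherentObj (F.obj A))
    {K' : ObjectProperty T'} (hK₁ : K'.IsSeparating) (hK₁' : ∀ ⦃A⦄, K' A → IsCompactObj A) {E : T}
    (hE : IsCoherentObj E) : IsCoherentObj (F.obj E) := by
  obtain ⟨κ, _, A, a, ha, hA⟩ := hE.isCompactObj.exists_cover hK (.of_epi (𝟙 E))
  refine .of_cover hK₁ hK₁' (ha.map F) (fun k => hF (hA k).1) fun k l => ?_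
  have hkl := hE.isCompactObj_chosen_pullback (a k) (a l) (hK' (hA k).1) (hK' (hA l).1)
  exact (hkl.map F hK fun A hA => (hF hA).isCompactObj).of_iso (PreservesPullback.iso F _ _)

end LeftAdjoint

section CoherentTopos

variable {E E' : Type (u + 1)} [Category.{u} E] [Category.{u} E']

lemma IsCoherentTopos.isCoherentObj_terminal [StableEpimorphicFamilies E] [HasTerminal E]
    (h : IsCoherentTopos E) : IsCoherentObj (⊤_ E) := by
  obtain ⟨K, hK, hsep, hlim⟩ := h.exists_generators
  have := hlim WalkingCospan
  have := hlim (Discrete PEmpty)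
  exact .of_isSeparating_of_isClosedUnderLimitsOfShape hsep hK (K.prop_limit _ nofun)

lemma IsCompactObj.of_equivalence (e : E ≌ E') {A : E} (hA : IsCompactObj A) :
    IsCompactObj (e.functor.obj A) := by
  intro ι D f hf
  obtain ⟨s, hs⟩ := hA.of_iso (e.unitIso.app A) _ _ (hf.map e.inverse)
  exact ⟨s, fun Z g g' hg => e.inverse.map_injective <| hs _ _ fun i => by
    simpa using congrArg e.inverse.map (hg i)⟩

lemma isClosedUnderIsomorphisms_of_isClosedUnderLimitsOfShape (K : ObjectProperty E)
    [K.IsClosedUnderLimitsOfShape WalkingCospan] : K.IsClosedUnderIsomorphisms where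
  of_iso {A B} e hA := by
    have hB : IsPullback e.inv e.inv (𝟙 A) (𝟙 A) := .of_vert_isIso ⟨by simp⟩
    exact K.prop_of_isLimit hB.isLimit (by rintro (_ | _ | _) <;> assumption)

lemma IsCoherentTopos.of_equivalence (h : IsCoherentTopos E) (e : E ≌ E') : IsCoherentTopos E' := by
  obtain ⟨⟨D, _, J, ⟨e'⟩⟩, K, hK, hsep, hlim⟩ := h
  have := hlim WalkingCospan
  have := isClosedUnderIsomorphisms_of_isClosedUnderLimitsOfShape K
  refine ⟨⟨D, inferInstance, J, ⟨e.symm.trans e'⟩⟩, K.inverseImage e.inverse, fun A hA => ?_, ?_,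
    fun J _ _ => have := hlim J; inferInstance⟩
  · exact ((hK _ hA).of_equivalence e).of_iso (e.counitIso.app A)
  · refine (hsep.of_equivalence e).of_le ?_
    rintro _ ⟨A, hA⟩
    exact K.prop_of_iso (e.unitIso.app A) hA

lemma isCoherentTopos_congr (e : E ≌ E') : IsCoherentTopos E ↔ IsCoherentTopos E' :=
  ⟨fun h => h.of_equivalence e, fun h => h.of_equivalence e.symm⟩

end CoherentTopos

section SheafOfTypes

open Opposite

variable {C : Type w} [Category.{v} C] {J : GrothendieckTopology C}

lemma isEpimorphicFamily_of_locally {E : Sheaf J (Type w')} {ι : Type*}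
    {D : ι → Sheaf J (Type w')} {f : ∀ i, D i ⟶ E}
    (h : ∀ (U : C) (s : E.obj.obj (op U)), ∃ S ∈ J U, ∀ ⦃V : C⦄ (g : V ⟶ U), S g →
      ∃ i t, (f i).hom.app (op V) t = E.obj.map g.op s) :
    IsEpimorphicFamily D f := by
  intro Z a b hab
  ext U s
  obtain ⟨S, hS, hs⟩ := h U.unop s
  refine (((isSheaf_iff_isSheaf_of_type _ _).1 Z.property).isSeparated S hS).ext fun V g hg => ?_
  obtain ⟨i, t, ht⟩ := hs g hg
  change Z.obj.map g.op (a.hom.app U s) = Z.obj.map g.op (b.hom.app U s)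
  rw [← NatTrans.naturality_apply, ← NatTrans.naturality_apply, ← ht]
  exact congrArg (fun k => k.hom.app (op V) t) (hab i)

variable [Balanced (Sheaf J (Type w'))]

lemma IsEpimorphicFamily.locally {E : Sheaf J (Type w')} {ι : Type*}
    {D : ι → Sheaf J (Type w')} {f : ∀ i, D i ⟶ E} (hf : IsEpimorphicFamily D f) {U : C}
    (s : E.obj.obj (op U)) : ∃ S ∈ J U, ∀ ⦃V : C⦄ (g : V ⟶ U), S g →
      ∃ i t, (f i).hom.app (op V) t = E.obj.map g.op s := by
  let A : Subfunctor E.obj := ⨆ i, Subfunctor.range (f i).hom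
  let B : Sheaf J (Type w') := ⟨(A.sheafify J).toFunctor, (isSheaf_iff_isSheaf_of_type _ _).2 <|
    A.sheafify_isSheaf ((isSheaf_iff_isSheaf_of_type _ _).1 E.property)⟩
  let j : B ⟶ E := ⟨(A.sheafify J).ι⟩
  have : Epi j := ⟨fun a b hab => hf a b fun i => by
    have hi : Subfunctor.range (f i).hom ≤ A.sheafify J :=
      (le_iSup (fun i => Subfunctor.range (f i).hom) i).trans (A.le_sheafify J)
    let l : D i ⟶ B := ⟨Subfunctor.lift (f i).hom hi⟩
    have hl : l ≫ j = f i := by ext; rfl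
    rw [← hl, Category.assoc, Category.assoc, hab]⟩
  have : Mono j := (sheafToPresheaf J _).mono_of_mono_map (inferInstanceAs (Mono (A.sheafify J).ι))
  have := isIso_of_mono_of_epi j
  have : Epi (A.sheafify J).ι := inferInstanceAs (Epi ((sheafToPresheaf J _).map j))
  have hA : A.sheafify J = ⊤ := by rw [← (A.sheafify J).range_ι, Subfunctor.range_eq_top]
  have hs : s ∈ (A.sheafify J).obj (op U) := hA ▸ Set.mem_univ s
  refine ⟨_, hs, fun V g hg => ?_⟩
  have hgs : E.obj.map g.op s ∈ A.obj (op V) := hg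
  rwa [Subfunctor.iSup_obj, Set.mem_iUnion] at hgs

instance : StableEpimorphicFamilies (Sheaf J (Type w')) where
  stable {E E'} g ι D f hf := isEpimorphicFamily_of_locally fun U s => by
    obtain ⟨S, hS, hs⟩ := hf.locally (g.hom.app (op U) s)
    refine ⟨S, hS, fun V k hk => ?_⟩
    obtain ⟨i, t, ht⟩ := hs k hk
    have hP := (IsPullback.of_hasPullback (f i) g).map
      (sheafToPresheaf J (Type w') ⋙ (evaluation _ _).obj (op V))
    obtain ⟨r, -, hr⟩ := Types.exists_of_isPullback hP t (E'.obj.map k.op s) <|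
      ht.trans (NatTrans.naturality_apply g.hom k.op s).symm
    exact ⟨i, r, hr⟩

end SheafOfTypes

section SheavesOnSpace

open TopologicalSpace Opposite

variable {X : Type u} [TopologicalSpace X]

instance subcanonical_opens_grothendieckTopology : (Opens.grothendieckTopology X).Subcanonical :=
  .of_isSheaf_yoneda_obj _ fun W U S hS x _ => by
    have hUW : U ≤ W := fun p hp => by
      obtain ⟨V, f, hf, hV⟩ := hS p hp
      exact leOfHom (x f hf) hV
    exact ⟨homOfLE hUW, fun V _ _ => Subsingleton.elim (α := V ⟶ W) _ _,
      fun _ _ => Subsingleton.elim (α := U ⟶ W) _ _⟩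

/-- The sheaf represented by an open set. -/
noncomputable abbrev opensSheaf (U : Opens X) : Sheaf (Opens.grothendieckTopology X) (Type u) :=
  (Opens.grothendieckTopology X).yoneda.obj U

/-- The support of a sheaf of sets: the union of the open sets over which it has a section. It is
the image of the sheaf in the terminal sheaf. -/
def support (F : Sheaf (Opens.grothendieckTopology X) (Type u)) : Opens X :=
  ⨆ (V : Opens X) (_ : Nonempty (F.obj.obj (op V))), V

variable {F G : Sheaf (Opens.grothendieckTopology X) (Type u)} {U : Opens X}

lemma le_support (s : F.obj.obj (op U)) : U ≤ support F :=
  le_iSup₂_of_le U ⟨s⟩ le_rfl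

lemma mem_support {p : X} : p ∈ support F ↔ ∃ V : Opens X, p ∈ V ∧ Nonempty (F.obj.obj (op V)) := by
  simp [support, and_comm]

lemma support_mono (f : F ⟶ G) : support F ≤ support G :=
  iSup₂_le fun V ⟨s⟩ => le_support (f.hom.app (op V) s)

lemma isSubterminal_opensSheaf (U : Opens X) : IsSubterminal (opensSheaf U) := by
  intro Z f g
  ext V x
  exact Subsingleton.elim (α := unop V ⟶ U) _ _

lemma support_opensSheaf (U : Opens X) : support (opensSheaf U) = U :=
  le_antisymm (iSup₂_le fun _ ⟨s⟩ => leOfHom s) (le_support (F := opensSheaf U) (𝟙 U))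

lemma nonempty_hom_opensSheaf_iff : Nonempty (F ⟶ opensSheaf U) ↔ support F ≤ U := by
  refine ⟨fun ⟨f⟩ => (support_mono f).trans (support_opensSheaf U).le, fun h => ⟨⟨?_⟩⟩⟩
  exact
    { app V := TypeCat.ofHom fun s => homOfLE ((le_support s).trans h)
      naturality V W f := by ext; exact Subsingleton.elim (α := unop W ⟶ U) _ _ }

lemma isEpimorphicFamily_opensSheaf_iff {ι : Type*}
    {D : ι → Sheaf (Opens.grothendieckTopology X) (Type u)} {f : ∀ i, D i ⟶ opensSheaf U} :
    IsEpimorphicFamily D f ↔ U ≤ ⨆ i, support (D i) := by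
  constructor
  · intro hf p hp
    obtain ⟨S, hS, hs⟩ := hf.locally (𝟙 U)
    obtain ⟨V, g, hg, hpV⟩ := hS p hp
    obtain ⟨i, t, -⟩ := hs g hg
    exact Opens.mem_iSup.2 ⟨i, le_support t hpV⟩
  · refine fun h => isEpimorphicFamily_of_locally fun V s =>
      ⟨⟨fun W _ => ∃ i, Nonempty ((D i).obj.obj (op W)), ?_⟩, fun p hp => ?_, ?_⟩
    · exact fun ⟨i, ⟨t⟩⟩ k => ⟨i, ⟨(D i).obj.map k.op t⟩⟩
    · obtain ⟨i, hi⟩ := Opens.mem_iSup.1 (h (leOfHom s hp))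
      obtain ⟨W, hpW, ⟨t⟩⟩ := mem_support.1 hi
      exact ⟨V ⊓ W, homOfLE inf_le_left, ⟨i, ⟨(D i).obj.map (homOfLE inf_le_right).op t⟩⟩,
        ⟨hp, hpW⟩⟩
    · exact fun W g ⟨i, ⟨t⟩⟩ => ⟨i, t, Subsingleton.elim (α := W ⟶ U) _ _⟩

lemma isCompactObj_opensSheaf_iff : IsCompactObj (opensSheaf U) ↔ IsCompact (U : Set X) := by
  constructor
  · rw [← Opens.isCompactElement_iff,
      CompleteLattice.isCompactElement_iff_exists_le_iSup_of_le_iSup]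
    intro hU ι V hV
    let f (i : ULift.{u + 1} ι) : opensSheaf (U ⊓ V i.down) ⟶ opensSheaf U :=
      (Opens.grothendieckTopology X).yoneda.map (homOfLE inf_le_left)
    obtain ⟨t, ht⟩ := hU _ f <| isEpimorphicFamily_opensSheaf_iff.2 <| by
      simpa only [support_opensSheaf, ← inf_iSup_eq, iSup_ulift] using le_inf le_rfl hV
    refine ⟨t.map Equiv.ulift.toEmbedding, (isEpimorphicFamily_opensSheaf_iff.1 ht).trans ?_⟩
    rw [Finset.sup_map]
    refine iSup_le fun i => (support_opensSheaf _).trans_le (inf_le_right.trans ?_)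
    exact Finset.le_sup (f := V ∘ ULift.down) i.2
  · intro hU ι D f hf
    obtain ⟨t, ht⟩ := hU.elim_finite_subcover (fun i => (support (D i) : Set X))
      (fun i => (support (D i)).isOpen) <| by
        rw [← Opens.coe_iSup]
        exact isEpimorphicFamily_opensSheaf_iff.1 hf
    refine ⟨t, isEpimorphicFamily_opensSheaf_iff.2 fun p hp => ?_⟩
    obtain ⟨i, hi, hpi⟩ := Set.mem_iUnion₂.1 (ht hp)
    exact Opens.mem_iSup.2 ⟨⟨i, hi⟩, hpi⟩

lemma IsCompactObj.isCompact_support (hF : IsCompactObj F) : IsCompact (support F : Set X) := by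
  obtain ⟨f⟩ := nonempty_hom_opensSheaf_iff.2 (le_refl (support F))
  refine isCompactObj_opensSheaf_iff.1 (.of_cover (ι := PUnit) (d := fun _ => f) ?_ fun _ => hF)
  exact isEpimorphicFamily_opensSheaf_iff.2 (le_iSup_of_le ⟨⟩ le_rfl)

variable (X) in
/-- The sheaves represented by compact open sets, up to isomorphism. -/
def IsCompactOpensSheaf : ObjectProperty (Sheaf (Opens.grothendieckTopology X) (Type u)) :=
  fun F => ∃ U : Opens X, IsCompact (U : Set X) ∧ Nonempty (F ≅ opensSheaf U)

lemma IsCompactOpensSheaf.isCompactObj (hF : IsCompactOpensSheaf X F) : IsCompactObj F := by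
  obtain ⟨U, hU, ⟨e⟩⟩ := hF
  exact (isCompactObj_opensSheaf_iff.2 hU).of_iso e.symm

lemma isSeparating_isCompactOpensSheaf [PrespectralSpace X] :
    (IsCompactOpensSheaf X).IsSeparating := by
  refine fun F G f g h => (Opens.grothendieckTopology X).hom_ext_yoneda fun U s => ?_
  let i (V : {V : Opens X // IsCompact (V : Set X) ∧ V ≤ U}) : opensSheaf V.1 ⟶ opensSheaf U :=
    (Opens.grothendieckTopology X).yoneda.map (homOfLE V.2.2)
  have hi : IsEpimorphicFamily _ i := isEpimorphicFamily_opensSheaf_iff.2 fun p hp => by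
    obtain ⟨V, hV, hpV, hVU⟩ := Opens.isBasis_iff_nbhd.1 (PrespectralSpace.isBasis_opens X) hp
    exact Opens.mem_iSup.2 ⟨⟨V, hV, hVU⟩, (support_opensSheaf V).ge hpV⟩
  refine hi _ _ fun V => ?_
  simpa only [Category.assoc] using h _ ⟨V.1, V.2.1, ⟨.refl _⟩⟩ (i V ≫ s)

instance [SpectralSpace X] (J : Type*) [Category* J] [Finite J] :
    (IsCompactOpensSheaf X).IsClosedUnderLimitsOfShape J where
  limitsOfShape_le := by
    rintro F ⟨h⟩
    choose U hU e using h.prop_diag_obj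
    replace e j := (e j).some
    have subterminal_diag (j : J) : IsSubterminal (h.diag.obj j) := fun _ _ _ =>
      (cancel_mono (e j).hom).1 (isSubterminal_opensSheaf (U j) _ _)
    have subterminal_limit : IsSubterminal F := fun _ _ _ =>
      h.isLimit.hom_ext fun j => subterminal_diag j _ _
    obtain ⟨toInf⟩ : Nonempty (F ⟶ opensSheaf (⨅ j, U j)) := nonempty_hom_opensSheaf_iff.2 <|
      le_iInf fun j => nonempty_hom_opensSheaf_iff.1 ⟨h.π.app j ≫ (e j).hom⟩
    let ofInf : opensSheaf (⨅ j, U j) ⟶ F := h.isLimit.lift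
      { pt := _
        π :=
          { app j := (Opens.grothendieckTopology X).yoneda.map (homOfLE (iInf_le U j)) ≫ (e j).inv
            naturality _ j _ := subterminal_diag j _ _ } }
    refine ⟨⨅ j, U j, ?_, ⟨⟨toInf, ofInf, subterminal_limit _ _, isSubterminal_opensSheaf _ _ _⟩⟩⟩
    have := QuasiSeparatedSpace.isCompact_sInter (Set.finite_range fun j => (U j : Set X))
      (by rintro _ ⟨j, rfl⟩; exact .inl (U j).isOpen) (by rintro _ ⟨j, rfl⟩; exact hU j)
    simpa [Opens.coe_iInf] using this

lemma support_pullback_opensSheaf {V : Opens X} (f : opensSheaf U ⟶ G) (g : opensSheaf V ⟶ G)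
    (hG : IsSubterminal G) : support (pullback f g) = U ⊓ V := by
  refine le_antisymm (le_inf (nonempty_hom_opensSheaf_iff.1 ⟨pullback.fst f g⟩)
    (nonempty_hom_opensSheaf_iff.1 ⟨pullback.snd f g⟩)) ?_
  let a : opensSheaf (U ⊓ V) ⟶ opensSheaf U :=
    (Opens.grothendieckTopology X).yoneda.map (homOfLE inf_le_left)
  let b : opensSheaf (U ⊓ V) ⟶ opensSheaf V :=
    (Opens.grothendieckTopology X).yoneda.map (homOfLE inf_le_right)
  exact (support_opensSheaf (U ⊓ V)).ge.trans (support_mono (pullback.lift a b (hG _ _)))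

namespace IsCoherentTopos

lemma compactSpace (h : IsCoherentTopos (ShTop X)) : CompactSpace X := by
  have hT : IsCoherentObj (⊤_ (Sheaf (Opens.grothendieckTopology X) (Type u))) :=
    IsCoherentTopos.isCoherentObj_terminal h
  have hle : ⊤ ≤ support (⊤_ (Sheaf (Opens.grothendieckTopology X) (Type u))) :=
    (support_opensSheaf ⊤).ge.trans (support_mono (terminal.from _))
  have := hT.isCompactObj.isCompact_support
  rw [top_unique hle] at this
  exact ⟨this⟩

lemma quasiSeparatedSpace (h : IsCoherentTopos (ShTop X)) : QuasiSeparatedSpace X where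
  inter_isCompact U V hUo hU hVo hV := by
    have hT : IsCoherentObj (⊤_ (Sheaf (Opens.grothendieckTopology X) (Type u))) :=
      IsCoherentTopos.isCoherentObj_terminal h
    let U : Opens X := ⟨U, hUo⟩
    let V : Opens X := ⟨V, hVo⟩
    let f := terminal.from (opensSheaf U)
    let g := terminal.from (opensSheaf V)
    have hfg : IsCompactObj (pullback f g) := hT.isCompactObj_chosen_pullback f g
      (isCompactObj_opensSheaf_iff.2 hU) (isCompactObj_opensSheaf_iff.2 hV)
    have := hfg.isCompact_support
    rwa [support_pullback_opensSheaf f g (isSubterminal_of_terminal)] at this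

lemma prespectralSpace (h : IsCoherentTopos (ShTop X)) : PrespectralSpace X := by
  obtain ⟨K, hK, hsep, -⟩ := h.exists_generators
  refine ⟨isTopologicalBasis_of_isOpen_of_nhds (fun _ hU => hU.1) fun p U hp hU => ?_⟩
  have hle := isEpimorphicFamily_opensSheaf_iff.1 (.of_isSeparating hsep (opensSheaf ⟨U, hU⟩))
  obtain ⟨⟨A, f⟩, hpA⟩ := Opens.mem_iSup.1 (hle hp)
  exact ⟨support A.1, ⟨(support A.1).isOpen, (hK _ A.2).isCompact_support⟩, hpA,
    nonempty_hom_opensSheaf_iff.1 ⟨f⟩⟩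

end IsCoherentTopos

theorem isCoherentTopos_shTop [SpectralSpace X] : IsCoherentTopos (ShTop X) where
  isTopos := ⟨Opens X, inferInstance, Opens.grothendieckTopology X, ⟨.refl⟩⟩
  exists_generators := ⟨IsCompactOpensSheaf X, fun _ hA => hA.isCompactObj,
    isSeparating_isCompactOpensSheaf, fun J _ _ =>
      inferInstanceAs ((IsCompactOpensSheaf X).IsClosedUnderLimitsOfShape J)⟩

theorem isCoherentTopos_shTop_iff [T0Space X] [QuasiSober X] :
    IsCoherentTopos (ShTop X) ↔ SpectralSpace X := by
  refine ⟨fun h => ?_, fun _ => isCoherentTopos_shTop⟩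
  have := h.compactSpace
  have := h.quasiSeparatedSpace
  have := h.prespectralSpace
  exact {}

end SheavesOnSpace

section GeomMorphism

open TopologicalSpace Opposite

lemma IsCompactOpensSheaf.isCoherentObj {X : Type u} [TopologicalSpace X] [SpectralSpace X]
    {F : Sheaf (Opens.grothendieckTopology X) (Type u)} (hF : IsCompactOpensSheaf X F) :
    IsCoherentObj F :=
  .of_isSeparating_of_isClosedUnderLimitsOfShape isSeparating_isCompactOpensSheaf
    (fun _ hA => hA.isCompactObj) hF

namespace GeomMorphism

variable {X Y : TopCat.{u}} (f : X ⟶ Y)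

lemma nonempty_inverse_obj_opensSheaf_iso (U : Opens Y) :
    Nonempty ((ofTopCatHom f).inverse.obj (opensSheaf U) ≅ opensSheaf ((Opens.map f).obj U)) := by
  let JX := Opens.grothendieckTopology X
  let JY := Opens.grothendieckTopology Y
  let inverse : Sheaf JY (Type u) ⥤ Sheaf JX (Type u) := (ofTopCatHom f).inverse
  let direct : Sheaf JX (Type u) ⥤ Sheaf JY (Type u) := (ofTopCatHom f).direct
  let adj : inverse ⊣ direct := (ofTopCatHom f).adj
  let sections : Sheaf JX (Type u) ⥤ Type u := sheafToPresheaf _ _ ⋙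
    (evaluation _ _).obj (op ((Opens.map f).obj U))
  let c₁ : sections.CorepresentableBy (inverse.obj (opensSheaf U)) :=
    { homEquiv := fun {F} => (adj.homEquiv _ F).trans (JY.yonedaEquiv (F := direct.obj F))
      homEquiv_comp := fun {F G} g k => by
        change JY.yonedaEquiv (F := direct.obj G) (adj.homEquiv _ _ (k ≫ g)) = _
        rw [adj.homEquiv_naturality_right]
        rfl }
  let c₂ : sections.CorepresentableBy (opensSheaf ((Opens.map f).obj U)) :=
    { homEquiv := fun {F} => JX.yonedaEquiv (F := F)
      homEquiv_comp := fun _ _ => rfl }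
  exact ⟨c₁.uniqueUpToIso c₂⟩

variable {f}

lemma isInclusion_ofTopCatHom (hf : IsInducing f) : (ofTopCatHom f).IsInclusion := by
  have : (Opens.map f).IsLocallyFull (Opens.grothendieckTopology X) := ⟨fun {U V} g p hp =>
    ⟨(Opens.map f).obj (U ⊓ V), homOfLE fun q hq => hq.1, ⟨U ⊓ V, homOfLE inf_le_left, 𝟙 _,
      ⟨homOfLE inf_le_right, Subsingleton.elim _ _⟩, Subsingleton.elim _ _⟩, hp, leOfHom g hp⟩⟩
  have : (Opens.map f).IsCoverDense (Opens.grothendieckTopology X) := ⟨fun V p hp => by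
    obtain ⟨U, hU, e⟩ := hf.isOpen_iff.1 V.2
    have hV : V = (Opens.map f).obj ⟨U, hU⟩ := Opens.ext e.symm
    exact ⟨V, 𝟙 V, ⟨⟨⟨U, hU⟩, eqToHom hV, eqToHom hV.symm, Subsingleton.elim _ _⟩⟩, hp⟩⟩
  let pushforward := (Opens.map f).sheafPushforwardContinuous (Type u)
    (Opens.grothendieckTopology Y) (Opens.grothendieckTopology X)
  exact ⟨inferInstanceAs pushforward.Full, inferInstanceAs pushforward.Faithful⟩

lemma isCoherent_ofTopCatHom_iff [SpectralSpace X] [SpectralSpace Y] :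
    (ofTopCatHom f).IsCoherent ↔ IsSpectralMap f := by
  refine ⟨fun h => ⟨f.hom.continuous, fun U hUo hU => ?_⟩,
    fun h => ⟨isCoherentTopos_shTop, isCoherentTopos_shTop, fun A hA => ?_⟩⟩
  · obtain ⟨e⟩ := nonempty_inverse_obj_opensSheaf_iso f ⟨U, hUo⟩
    have hUc : IsCompactOpensSheaf Y (opensSheaf ⟨U, hUo⟩) := ⟨_, hU, ⟨.refl _⟩⟩
    have := h.map_coherent _ hUc.isCoherentObj
    exact isCompactObj_opensSheaf_iff.1 (this.isCompactObj.of_iso e)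
  · let F : Sheaf (Opens.grothendieckTopology Y) (Type u) ⥤
      Sheaf (Opens.grothendieckTopology X) (Type u) := (ofTopCatHom f).inverse
    have : F.IsLeftAdjoint := (ofTopCatHom f).adj.isLeftAdjoint
    have : PreservesFiniteLimits F := (ofTopCatHom f).preservesFiniteLimits
    refine IsCoherentObj.map F isSeparating_isCompactOpensSheaf (fun _ hA => hA.isCompactObj) ?_
      isSeparating_isCompactOpensSheaf (fun _ hA => hA.isCompactObj) hA
    rintro B ⟨U, hU, ⟨e⟩⟩
    obtain ⟨e'⟩ := nonempty_inverse_obj_opensSheaf_iso f U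
    have hFB : IsCompactOpensSheaf X (F.obj B) :=
      ⟨_, h.isCompact_preimage_of_isOpen U.isOpen hU, ⟨F.mapIso e ≪≫ e'⟩⟩
    exact hFB.isCoherentObj

end GeomMorphism

lemma isCoherentSubtopos_ofSubspace_iff {X : Type u} [TopologicalSpace X] [SpectralSpace X]
    {S : Set X} (hS : IsSoberSubspace S) :
    (GeomMorphism.ofSubspace S).IsCoherentSubtopos ↔ IsSpectralSubobject S := by
  have := hS.1
  have := hS.2
  refine ⟨fun h => ?_, fun ⟨hS, hval⟩ => ?_⟩
  · have := isCoherentTopos_shTop_iff.1 h.2.source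
    exact ⟨this, GeomMorphism.isCoherent_ofTopCatHom_iff.1 h.2⟩
  · exact ⟨GeomMorphism.isInclusion_ofTopCatHom .subtypeVal,
      GeomMorphism.isCoherent_ofTopCatHom_iff.2 hval⟩

end GeomMorphism

section FilterSpace

open TopologicalSpace Order

variable {P : Type u} [PartialOrder P]

instance isScott_pFilter : IsScott (PFilter P) Set.univ := ⟨rfl⟩

/-- The union of a nonempty set `d` of filters such that any two elements of the union lie in a
common member of `d`. This covers both directed sets, whose suprema are of this form, and
irreducible closed sets, whose generic points are of this form. -/
def unionFilter (d : Set (PFilter P)) (hne : d.Nonempty)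
    (hd : ∀ p q, (∃ x ∈ d, p ∈ x) → (∃ x ∈ d, q ∈ x) → ∃ x ∈ d, p ∈ x ∧ q ∈ x) : PFilter P :=
  IsPFilter.toPFilter (F := {p | ∃ x ∈ d, p ∈ x}) <| .of_def
    (hne.elim fun x hx => x.nonempty.imp fun _ hp => ⟨x, hx, hp⟩)
    (fun p hp q hq => by
      obtain ⟨x, hx, hpx, hqx⟩ := hd p q hp hq
      obtain ⟨r, hr, hrp, hrq⟩ := x.directed p hpx q hqx
      exact ⟨r, ⟨x, hx, hr⟩, hrp, hrq⟩)
    (fun hpq ⟨x, hx, hp⟩ => ⟨x, hx, PFilter.mem_of_le hpq hp⟩)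

lemma exists_mem_of_isLUB {d : Set (PFilter P)} (hne : d.Nonempty) (hd : DirectedOn (· ≤ ·) d)
    {x : PFilter P} (hx : IsLUB d x) {p : P} (hp : p ∈ x) : ∃ y ∈ d, p ∈ y := by
  have hunion (p q : P) : (∃ y ∈ d, p ∈ y) → (∃ y ∈ d, q ∈ y) → ∃ y ∈ d, p ∈ y ∧ q ∈ y := by
    rintro ⟨y, hy, hpy⟩ ⟨z, hz, hqz⟩
    obtain ⟨w, hw, hyw, hzw⟩ := hd y hy z hz
    exact ⟨w, hw, hyw hpy, hzw hqz⟩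
  exact hx.2 (show unionFilter d hne hunion ∈ upperBounds d from fun y hy q hq => ⟨y, hy, hq⟩) hp

lemma isLUB_principal_image (x : PFilter P) : IsLUB (PFilter.principal '' (x : Set P)) x :=
  ⟨Set.forall_mem_image.2 fun _ hp => PFilter.principal_le_iff.2 hp,
    fun _ hy p hp => PFilter.principal_le_iff.1 (hy ⟨p, hp, rfl⟩)⟩

lemma directedOn_principal_image (x : PFilter P) :
    DirectedOn (· ≤ ·) (PFilter.principal '' (x : Set P)) := by
  rintro _ ⟨p, hp, rfl⟩ _ ⟨q, hq, rfl⟩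
  obtain ⟨r, hr, hrp, hrq⟩ := x.directed p hp q hq
  exact ⟨_, ⟨r, hr, rfl⟩, PFilter.antitone_principal hrp, PFilter.antitone_principal hrq⟩

/-- The set of filters that contain `p`. These sets form a basis of compact open sets. -/
def filterNhd (p : P) : Set (PFilter P) := {x | p ∈ x}

lemma principal_mem_filterNhd {p q : P} : PFilter.principal p ∈ filterNhd q ↔ p ≤ q := Iff.rfl

lemma isOpen_filterNhd (p : P) : IsOpen (filterNhd p) :=
  (IsScott.isOpen_iff_isUpperSet_and_dirSupInaccOn (D := Set.univ)).2
    ⟨fun _ _ hxy hx => hxy hx, fun _ _ hne hd _ hx hp => exists_mem_of_isLUB hne hd hx hp⟩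

lemma filterNhd_subset_iff {U : Set (PFilter P)} (hU : IsOpen U) {p : P} :
    filterNhd p ⊆ U ↔ PFilter.principal p ∈ U :=
  ⟨fun h => h (principal_mem_filterNhd.2 le_rfl), fun h _ hx =>
    IsScott.isUpperSet_of_isOpen (D := Set.univ) hU (PFilter.principal_le_iff.2 hx) h⟩

lemma exists_mem_principal_mem {U : Set (PFilter P)} (hU : IsOpen U) {x : PFilter P}
    (hx : x ∈ U) : ∃ p ∈ x, PFilter.principal p ∈ U := by
  have hinacc := (IsScott.isOpen_iff_isUpperSet_and_dirSupInaccOn (D := Set.univ)).1 hU |>.2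
  obtain ⟨_, ⟨p, hp, rfl⟩, hpU⟩ := hinacc (Set.mem_univ _) (x.nonempty.image _)
    (directedOn_principal_image x) (isLUB_principal_image x) hx
  exact ⟨p, hp, hpU⟩

lemma isTopologicalBasis_filterNhd : IsTopologicalBasis (Set.range (filterNhd (P := P))) := by
  refine isTopologicalBasis_of_isOpen_of_nhds (Set.forall_mem_range.2 isOpen_filterNhd)
    fun x U hx hU => ?_
  obtain ⟨p, hp, hpU⟩ := exists_mem_principal_mem hU hx
  exact ⟨_, ⟨p, rfl⟩, hp, (filterNhd_subset_iff hU).2 hpU⟩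

lemma isCompact_filterNhd (p : P) : IsCompact (filterNhd p) := by
  refine isCompact_of_finite_subcover fun U hU hpU => ?_
  obtain ⟨i, hi⟩ := Set.mem_iUnion.1 (hpU (principal_mem_filterNhd.2 le_rfl))
  exact ⟨{i}, by simpa using (filterNhd_subset_iff (hU i)).2 hi⟩

instance t0Space_pFilter : T0Space (PFilter P) :=
  ⟨fun _ _ h => PFilter.ext _ _ (Set.ext fun p => h.mem_open_iff (isOpen_filterNhd p))⟩

instance quasiSober_pFilter : QuasiSober (PFilter P) where
  sober {Z} hZ hZc := by
    have hunion (p q : P) : (Z ∩ filterNhd p).Nonempty → (Z ∩ filterNhd q).Nonempty →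
        (Z ∩ (filterNhd p ∩ filterNhd q)).Nonempty :=
      hZ.2 _ _ (isOpen_filterNhd p) (isOpen_filterNhd q)
    refine ⟨unionFilter Z hZ.1 hunion, ?_⟩
    rw [IsGenericPoint, IsScott.closure_singleton]
    refine Set.Subset.antisymm (fun y hy => ?_) fun y hy p hp => ⟨y, hy, hp⟩
    rw [← hZc.closure_eq, isTopologicalBasis_filterNhd.mem_closure_iff]
    rintro _ ⟨p, rfl⟩ hp
    obtain ⟨z, hz, hpz⟩ := hy hp
    exact ⟨z, hpz, hz⟩

variable (P) in
/-- The functor `p ↦ filterNhd p` from `P` to the opens of its filter space. It embeds `P`, with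
the trivial topology, as a dense subsite, which identifies `PSh(P)` with sheaves on filters. -/
def filterNhdFunctor : P ⥤ Opens (PFilter P) :=
  Monotone.functor (f := fun p => ⟨filterNhd p, isOpen_filterNhd p⟩)
    fun _ _ hpq _ hx => PFilter.mem_of_le hpq hx

instance full_filterNhdFunctor : (filterNhdFunctor P).Full where
  map_surjective f :=
    ⟨homOfLE (principal_mem_filterNhd.1 (leOfHom f (principal_mem_filterNhd.2 le_rfl))),
      Subsingleton.elim _ _⟩

instance isDenseSubsite_filterNhdFunctor :
    (filterNhdFunctor P).IsDenseSubsite ⊥ (Opens.grothendieckTopology (PFilter P)) where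
  isCoverDense' := by
    refine ⟨fun U x hx => ?_⟩
    obtain ⟨p, hp, hpU⟩ := exists_mem_principal_mem U.isOpen hx
    have hpU : (filterNhdFunctor P).obj p ≤ U := (filterNhd_subset_iff U.isOpen).2 hpU
    exact ⟨_, homOfLE hpU, ⟨⟨p, 𝟙 _, homOfLE hpU, Subsingleton.elim _ _⟩⟩, hp⟩
  functorPushforward_mem_iff {p L} := by
    rw [GrothendieckTopology.bot_covering]
    refine ⟨fun h => ?_, fun h => ?_⟩
    · obtain ⟨V, -, ⟨q, f, g, hf, -⟩, hV⟩ := h _ (principal_mem_filterNhd.2 (le_refl p))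
      have hpq : p ≤ q := principal_mem_filterNhd.1 (leOfHom g hV)
      rw [← Sieve.id_mem_iff_eq_top, ← Subsingleton.elim (homOfLE hpq ≫ f) (𝟙 p)]
      exact L.downward_closed hf _
    · rw [h, Sieve.functorPushforward_top]
      exact GrothendieckTopology.top_mem _ _

variable (P) in
/-- Presheaves on `P` are sheaves on the space of filters on `P`. -/
noncomputable def presheafEquivShTop : (Pᵒᵖ ⥤ Type u) ≌ ShTop (PFilter P) :=
  (sheafBotEquivalence _).symm.trans <|
    Functor.IsDenseSubsite.sheafEquiv ⊥ (Opens.grothendieckTopology (PFilter P))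
      (filterNhdFunctor P) (Type u)

end FilterSpace

section SpectralMap

open TopologicalSpace

variable {X Y : Type*} [TopologicalSpace X] [TopologicalSpace Y] {f : X → Y}

lemma isSpectralMap_iff_of_isTopologicalBasis {ι : Type*} {b : ι → Set Y}
    (hb : IsTopologicalBasis (Set.range b)) (hbc : ∀ i, IsCompact (b i)) :
    IsSpectralMap f ↔ Continuous f ∧ ∀ i, IsCompact (f ⁻¹' b i) := by
  refine ⟨fun hf => ⟨hf.continuous, fun i =>
    hf.isCompact_preimage_of_isOpen (hb.isOpen ⟨i, rfl⟩) (hbc i)⟩,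
    fun ⟨hf, hfb⟩ => ⟨hf, fun {U} hU hUc => ?_⟩⟩
  obtain ⟨t, ht, rfl⟩ :=
    (isCompact_open_iff_eq_finite_iUnion_of_isTopologicalBasis b hb hbc U).1 ⟨hUc, hU⟩
  rw [Set.preimage_iUnion₂]
  exact ht.isCompact_biUnion fun i _ => hfb i

lemma compactSpace_of_isSpectralMap [CompactSpace Y] (hf : IsSpectralMap f) : CompactSpace X :=
  ⟨hf.isCompact_preimage_of_isOpen isOpen_univ isCompact_univ⟩

lemma quasiSeparatedSpace_of_isInducing [PrespectralSpace Y] [QuasiSeparatedSpace Y]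
    (hf : IsInducing f) (hfs : IsSpectralMap f) : QuasiSeparatedSpace X := by
  have hb := (PrespectralSpace.isTopologicalBasis (X := Y)).isInducing hf
  rw [Set.image_eq_range] at hb
  refine .of_isTopologicalBasis hb fun ⟨U, hU, hUc⟩ ⟨V, hV, hVc⟩ => ?_
  exact hfs.isCompact_preimage_of_isOpen (hU.inter hV) (hUc.inter_of_isOpen hVc hU hV)

lemma isSpectralSubobject_iff_isSpectralMap [SpectralSpace X] {S : Set X}
    (hS : IsSoberSubspace S) :
    IsSpectralSubobject S ↔ IsSpectralMap (Subtype.val : S → X) := by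
  refine ⟨fun h => h.2, fun h => ⟨?_, h⟩⟩
  have := hS.1
  have := hS.2
  have := compactSpace_of_isSpectralMap h
  have := quasiSeparatedSpace_of_isInducing .subtypeVal h
  have := PrespectralSpace.of_isInducing _ .subtypeVal h
  constructor

end SpectralMap

section Patch

open WithTopology

section ConstructibleTopology

variable {X Y : Type*} [TopologicalSpace X] [TopologicalSpace Y]

lemma isClopen_ofTopology_preimage {U : Set X} (hU : IsOpen U) (hUc : IsCompact U) :
    IsClopen (ofTopology ⁻¹' U : Set (WithConstructibleTopology X)) :=
  ⟨⟨WithConstructibleTopology.isOpen_iff.2 <|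
      IsCompact.isOpen_constructibleTopology_of_isClosed (s := Uᶜ) ((compl_compl U).symm ▸ hUc)
        hU.isClosed_compl⟩,
    WithConstructibleTopology.isOpen_iff.2 (hUc.isOpen_constructibleTopology_of_isOpen hU)⟩

lemma continuous_withConstructibleTopology_ofTopology [PrespectralSpace X] :
    Continuous (ofTopology : WithConstructibleTopology X → X) :=
  PrespectralSpace.isTopologicalBasis.continuous_iff.2 fun _ hU =>
    (isClopen_ofTopology_preimage hU.1 hU.2).isOpen

lemma continuous_withConstructibleTopology_map {f : X → Y} (hf : IsSpectralMap f) :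
    Continuous (fun z : WithConstructibleTopology X =>
      (toTopology _ (f z.ofTopology) : WithConstructibleTopology Y)) := by
  refine @Continuous.comp _ _ _ _ (constructibleTopology Y) _ _ _ (continuous_toTopology _)
    (continuous_generateFrom_iff.2 ?_)
  have key {U : Set Y} (hU : IsOpen U) (hUc : IsCompact U) :=
    isClopen_ofTopology_preimage (hU.preimage hf.continuous)
      (hf.isCompact_preimage_of_isOpen hU hUc)
  rintro U (⟨hU, hUc⟩ | ⟨hU, hUc⟩)
  · exact (key hU hUc).isOpen
  · exact isClosed_compl_iff.1 (key hU.isOpen_compl hUc).isClosed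

instance totallySeparatedSpace_withConstructibleTopology [T0Space X] [PrespectralSpace X] :
    TotallySeparatedSpace (WithConstructibleTopology X) := by
  refine totallySeparatedSpace_iff_exists_isClopen.2 fun x y hxy => ?_
  obtain ⟨V, ⟨hV, hVc⟩, hxyV⟩ : ∃ V ∈ {V : Set X | IsOpen V ∧ IsCompact V},
      ¬(x.ofTopology ∈ V ↔ y.ofTopology ∈ V) := by
    contrapose! hxy
    exact ofTopology_injective _ (PrespectralSpace.isTopologicalBasis.eq_iff.2 hxy)
  have hcl := isClopen_ofTopology_preimage hV hVc
  by_cases hx : x.ofTopology ∈ V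
  · exact ⟨_, hcl, hx, fun hy => hxyV (iff_of_true hx hy)⟩
  · exact ⟨_, hcl.compl, hx, fun hy => hxyV (iff_of_false hx hy)⟩

end ConstructibleTopology

variable {X Y : Type u} [TopologicalSpace X] [TopologicalSpace Y]

lemma isPatch_iff_isClosed_ofTopology_preimage {S : Set X} :
    IsPatch S ↔ IsClosed (ofTopology ⁻¹' S : Set (WithConstructibleTopology X)) :=
  (WithConstructibleTopology.isClosed_iff (s := ofTopology ⁻¹' S)).symm

lemma IsPatch.isCompact_inter [SpectralSpace X] {S U : Set X} (hS : IsPatch S) (hU : IsOpen U)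
    (hUc : IsCompact U) : IsCompact (S ∩ U) := by
  have hcl := (isPatch_iff_isClosed_ofTopology_preimage.1 hS).inter
    (isClopen_ofTopology_preimage hU hUc).isClosed
  rw [← Set.preimage_inter] at hcl
  rw [← Set.image_preimage_eq (S ∩ U) (ofTopology_surjective (constructibleTopology X))]
  exact hcl.isCompact.image continuous_withConstructibleTopology_ofTopology

lemma isPatch_range_of_isSpectralMap [SpectralSpace X] [T0Space Y] [PrespectralSpace Y] {f : X → Y}
    (hf : IsSpectralMap f) : IsPatch (Set.range f) := by
  rw [isPatch_iff_isClosed_ofTopology_preimage]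
  convert (isCompact_range (continuous_withConstructibleTopology_map hf)).isClosed
  ext y
  exact ⟨fun ⟨x, hx⟩ => ⟨toTopology _ x, ofTopology_injective _ hx⟩,
    fun ⟨x, hx⟩ => ⟨x.ofTopology, congrArg ofTopology hx⟩⟩

theorem isPatch_iff_isSpectralSubobject [SpectralSpace X] {S : Set X} (hS : IsSoberSubspace S) :
    IsPatch S ↔ IsSpectralSubobject S := by
  refine ⟨fun h => (isSpectralSubobject_iff_isSpectralMap hS).2
    ⟨continuous_subtype_val, fun _ hU hUc => ?_⟩, fun ⟨_, h⟩ => ?_⟩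
  · rw [Subtype.isCompact_iff, Subtype.image_preimage_coe]
    exact h.isCompact_inter hU hUc
  · simpa only [Subtype.range_coe] using isPatch_range_of_isSpectralMap h

end Patch

section FiniteType

open TopologicalSpace Order

variable {P : Type u} [PartialOrder P] {S : Set (PFilter P)}

lemma mem_topologyOfSet_iff {p : P} {L : Sieve p} :
    L ∈ topologyOfSet S p ↔ ∀ x ∈ S, p ∈ x → ∃ (q : P) (f : q ⟶ p), L f ∧ q ∈ x := by
  change _ ∩ S ⊆ sieveTilde L ↔ _
  simp only [Set.subset_def, sieveTilde, Set.mem_inter_iff, Set.mem_ofPred_eq,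
    PFilter.principal_le_iff]
  exact ⟨fun h x hx hp => h x ⟨hp, hx⟩, fun h x hx => h x hx.2 hx.1⟩

lemma isSpectralMap_subtypeVal_iff_forall_isCompact_filterNhd_inter :
    IsSpectralMap (Subtype.val : S → PFilter P) ↔ ∀ p : P, IsCompact (filterNhd p ∩ S) := by
  simp only [isSpectralMap_iff_of_isTopologicalBasis isTopologicalBasis_filterNhd
    isCompact_filterNhd, continuous_subtype_val, true_and, Subtype.isCompact_iff,
    Subtype.image_preimage_coe, Set.inter_comm S]

/-- The sieve of those `q ≤ p` whose basic open set `filterNhd q` is contained in a member of a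
family `U` of open sets; it is `K_S`-covering when `U` covers the part of `S` above `p`. -/
def sieveOfOpens {ι : Type*} (U : ι → Set (PFilter P)) (p : P) : Sieve p where
  arrows q _ := ∃ i, filterNhd q ⊆ U i
  downward_closed := fun ⟨i, hi⟩ g =>
    ⟨i, fun _ hx => hi (PFilter.mem_of_le (leOfHom g) hx)⟩

lemma sieveOfOpens_mem_topologyOfSet {ι : Type*} {U : ι → Set (PFilter P)}
    (hU : ∀ i, IsOpen (U i)) {p : P} (hp : filterNhd p ∩ S ⊆ ⋃ i, U i) :
    sieveOfOpens U p ∈ topologyOfSet S p := by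
  refine mem_topologyOfSet_iff.2 fun x hx hpx => ?_
  obtain ⟨i, hi⟩ := Set.mem_iUnion.1 (hp ⟨hpx, hx⟩)
  obtain ⟨q, hq, hqi⟩ := exists_mem_principal_mem (hU i) hi
  obtain ⟨r, hr, hrp, hrq⟩ := x.directed p hpx q hq
  exact ⟨r, homOfLE hrp, ⟨i, fun y hy =>
    (filterNhd_subset_iff (hU i)).2 hqi (PFilter.mem_of_le hrq hy)⟩, hr⟩

lemma isCompact_filterNhd_inter_of_isOfFiniteType (h : (topologyOfSet S).IsOfFiniteType) (p : P) :
    IsCompact (filterNhd p ∩ S) := by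
  classical
  refine isCompact_of_finite_subcover fun U hU hpU => ?_
  obtain ⟨n, Y, f, hf, hle⟩ := h _ (sieveOfOpens_mem_topologyOfSet hU hpU)
  choose i hi using fun k => hle _ (Sieve.ofArrows_mk Y f k)
  refine ⟨Finset.univ.image i, fun x ⟨hpx, hx⟩ => ?_⟩
  obtain ⟨q, g, hg, hq⟩ := mem_topologyOfSet_iff.1 hf x hx hpx
  obtain ⟨k, a, -⟩ := (Sieve.mem_ofArrows_iff _ _ _).1 hg
  exact Set.mem_biUnion (Finset.mem_image_of_mem i (Finset.mem_univ k))
    (hi k (PFilter.mem_of_le (leOfHom a) hq))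

lemma isOfFiniteType_of_forall_isCompact_filterNhd_inter
    (h : ∀ p : P, IsCompact (filterNhd p ∩ S)) : (topologyOfSet S).IsOfFiniteType := by
  intro p L hL
  obtain ⟨t, ht⟩ := (h p).elim_finite_subcover
    (fun q : {q : P // ∃ f : q ⟶ p, L f} => filterNhd q.1) (fun _ => isOpen_filterNhd _)
    (fun x ⟨hpx, hx⟩ => by
      obtain ⟨q, f, hf, hq⟩ := mem_topologyOfSet_iff.1 hL x hx hpx
      exact Set.mem_iUnion.2 ⟨⟨q, f, hf⟩, hq⟩)
  choose f hf using fun k => (t.equivFin.symm k).1.2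
  refine ⟨t.card, _, f, mem_topologyOfSet_iff.2 fun x hx hpx => ?_,
    (Sieve.generate_le_iff _ _).2 (Presieve.ofArrows_le_iff.2 hf)⟩
  obtain ⟨q, hq, hqx⟩ := Set.mem_iUnion₂.1 (ht ⟨hpx, hx⟩)
  refine ⟨_, _, Sieve.ofArrows_mk _ _ (t.equivFin ⟨q, hq⟩), ?_⟩
  rwa [Equiv.symm_apply_apply]

theorem isOfFiniteType_topologyOfSet_iff :
    (topologyOfSet S).IsOfFiniteType ↔ IsSpectralMap (Subtype.val : S → PFilter P) := by
  rw [isSpectralMap_subtypeVal_iff_forall_isCompact_filterNhd_inter]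
  exact ⟨isCompact_filterNhd_inter_of_isOfFiniteType,
    isOfFiniteType_of_forall_isCompact_filterNhd_inter⟩

end FiniteType

theorem mainTheorem2 {P : Type u} [PartialOrder P] :
    (IsCoherentTopos (Pᵒᵖ ⥤ Type u) ↔ SpectralSpace (Order.PFilter P)) ∧
    (SpectralSpace (Order.PFilter P) →
      ∀ S : Set (Order.PFilter P), IsSoberSubspace S →
        [IsPatch S,
          IsSpectralSubobject S,
          (topologyOfSet S).IsOfFiniteType,
          (GeomMorphism.ofSubspace S).IsCoherentSubtopos].TFAE) := by
  refine ⟨(isCoherentTopos_congr (presheafEquivShTop P)).trans isCoherentTopos_shTop_iff,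
    fun hX S hS => ?_⟩
  tfae_have 1 ↔ 2 := isPatch_iff_isSpectralSubobject hS
  tfae_have 2 ↔ 3 :=
    (isSpectralSubobject_iff_isSpectralMap hS).trans isOfFiniteType_topologyOfSet_iff.symm
  tfae_have 4 ↔ 2 := isCoherentSubtopos_ofSubspace_iff hS
  tfae_finish
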